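/- For integers $a_1,\dots,a_n$ let $P(a_1,\dots,a_n)$ be the pretzel link diagram consisting of $n$ vertical two-strand columns placed side by side, the $i$-th with $|a_i|$ crossings of the sign of $a_i$ (for $a_i>0$ the column, read as a vertical two-strand braid, is $\sigma_1^{a_i}$), the right strand of each column being joined at the top and at the bottom to the left strand of the next column, and the left strand of the first column to the right strand of the last one. Let $n>2$ be even. Then $P(a_1,\dots,a_n)$ and the closure $\hat\beta$ of the following braid word $\beta$ on $n$ strands are diagrams of the same (unoriented) link, i.e. they are related by planar isotopy and Reidemeister moves: $$\beta=\bigl(\sigma_1\sigma_2\cdots\sigma_{n-2}\bigr)\,\bigl(\sigma_{n-1}^{a_1}\sigma_{n-3}^{a_3}\cdots\sigma_1^{a_{n-1}}\bigr)\,\bigl(\sigma_{n-2}^{-1}\sigma_{n-3}^{-1}\cdots\sigma_1^{-1}\bigr)\,\bigl(\sigma_{n-1}^{a_2}\sigma_{n-3}^{a_4}\cdots\sigma_1^{a_n}\bigr).$$ The braid word $\beta$ has $2n+\sum_{i=1}^n|a_i|-4$ crossings (letters) and $n$ strands. -/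

import Mathlib

/-!
# Link diagrams, pretzel diagrams and closed braids

A (generic, unoriented) link diagram in the plane is cut by horizontal lines into slices, each of
which contains one elementary piece (a local minimum, a local maximum or a crossing) and
otherwise vertical strands. It is recorded as the list of its slices, read from bottom to top.
The strands met by a horizontal line are numbered `0, 1, 2, …` from left to right.
-/

/-- The elementary pieces of a link diagram.
* `cup`: a local minimum `∪`, where two strands begin;
* `cap`: a local maximum `∩`, where two strands end;
* `cross s`: a crossing of two vertical strands. If `s = true` the strand running from bottom left
  to top right passes over the other one (a positive crossing when both strands are oriented
  upwards, the braid generator `σ`); if `s = false` it passes under it (`σ⁻¹`). -/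
inductive Piece where
  | cup : Piece
  | cap : Piece
  | cross (s : Bool) : Piece

/-- Number of strands that enter a piece from below. -/
def Piece.inputs : Piece → ℕ
  | .cup => 0
  | .cap => 2
  | .cross _ => 2

/-- Number of strands that leave a piece at its top. -/
def Piece.outputs : Piece → ℕ
  | .cup => 2
  | .cap => 0
  | .cross _ => 2

/-- A slice: one piece, with `pos` vertical strands to its left. -/
structure Slice where
  piece : Piece
  pos : ℕ

/-- `IsTangle m l m'`: the slices `l`, stacked from bottom to top, fit together to a diagram with
`m` end points on the bottom line and `m'` end points on the top line. In each slice, `r` is the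
number of vertical strands to the right of the piece. -/
def IsTangle : ℕ → List Slice → ℕ → Prop
  | m, [], m' => m = m'
  | m, s :: l, m' =>
      ∃ r, m = s.pos + s.piece.inputs + r ∧ IsTangle (s.pos + s.piece.outputs + r) l m'

/-- A link diagram: a stack of slices without end points. -/
structure LinkDiagram where
  slices : List Slice
  closed : IsTangle 0 slices 0

/-- The local moves between pieces of diagrams: planar isotopy (exchange of the heights of two
distant pieces, straightening of a zigzag, turning a crossing around a local extremum) and the
three Reidemeister moves. -/
inductive LocalMove : List Slice → List Slice → Prop
  /-- Two pieces `p`, `q`, with `p` to the left of `q` and `k` strands between them, are moved past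
  each other vertically. -/
  | exchange (p q : Piece) (i k : ℕ) :
      LocalMove [⟨q, i + p.inputs + k⟩, ⟨p, i⟩] [⟨p, i⟩, ⟨q, i + p.outputs + k⟩]
  | zigzag_left (i : ℕ) : LocalMove [⟨.cup, i⟩, ⟨.cap, i + 1⟩] []
  | zigzag_right (i : ℕ) : LocalMove [⟨.cup, i + 1⟩, ⟨.cap, i⟩] []
  /-- A strand that crosses the left arm of a cup is moved to cross its right arm instead. It
  stays over (or under) the cup; as it now leans the other way, the crossing is recorded with the
  opposite `s`. -/
  | turn_cup (s : Bool) (i : ℕ) :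
      LocalMove [⟨.cup, i + 1⟩, ⟨.cross s, i⟩] [⟨.cup, i⟩, ⟨.cross (!s), i + 1⟩]
  /-- The same for a cap. -/
  | turn_cap (s : Bool) (i : ℕ) :
      LocalMove [⟨.cross s, i⟩, ⟨.cap, i + 1⟩] [⟨.cross (!s), i + 1⟩, ⟨.cap, i⟩]
  /-- First Reidemeister move: a curl at a local minimum or maximum is removed. -/
  | reidemeister_one_cup (s : Bool) (i : ℕ) :
      LocalMove [⟨.cup, i⟩, ⟨.cross s, i⟩] [⟨.cup, i⟩]
  | reidemeister_one_cap (s : Bool) (i : ℕ) :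
      LocalMove [⟨.cross s, i⟩, ⟨.cap, i⟩] [⟨.cap, i⟩]
  /-- Second Reidemeister move. -/
  | reidemeister_two (s : Bool) (i : ℕ) :
      LocalMove [⟨.cross s, i⟩, ⟨.cross (!s), i⟩] []
  /-- Third Reidemeister move. -/
  | reidemeister_three (s : Bool) (i : ℕ) :
      LocalMove [⟨.cross s, i⟩, ⟨.cross s, i + 1⟩, ⟨.cross s, i⟩]
        [⟨.cross s, i + 1⟩, ⟨.cross s, i⟩, ⟨.cross s, i + 1⟩]

/-- One local move, applied somewhere inside a link diagram. -/
def LinkDiagram.Move (D D' : LinkDiagram) : Prop :=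
  ∃ lower before after upper : List Slice, LocalMove before after ∧
    D.slices = lower ++ before ++ upper ∧ D'.slices = lower ++ after ++ upper

/-- Two diagrams represent the same (unoriented) link: they are connected by finitely many planar
isotopies and Reidemeister moves, in either direction. -/
def LinkDiagram.SameLink : LinkDiagram → LinkDiagram → Prop :=
  Relation.EqvGen LinkDiagram.Move

/-! ### Auxiliary facts: the diagrams below are well formed -/

theorem IsTangle.append {l₁ l₂ : List Slice} {m₁ m₂ m₃ : ℕ} (h₁ : IsTangle m₁ l₁ m₂)
    (h₂ : IsTangle m₂ l₂ m₃) : IsTangle m₁ (l₁ ++ l₂) m₃ := by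
  induction l₁ generalizing m₁ with
  | nil => cases h₁; exact h₂
  | cons s l ih =>
    obtain ⟨r, hr, h⟩ := h₁
    exact ⟨r, hr, ih h⟩

theorem IsTangle.cups (m : ℕ) (f : ℕ → ℕ) (n : ℕ) (hf : ∀ k < n, f k ≤ m + 2 * k) :
    IsTangle m ((List.range n).map fun k => ⟨.cup, f k⟩) (m + 2 * n) := by
  induction n with
  | zero => rfl
  | succ n ih =>
    rw [List.range_succ, List.map_append]
    refine (ih fun k hk => hf k (by omega)).append ⟨m + 2 * n - f n, ?_, ?_⟩
    · have := hf n (by omega)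
      simp only [Piece.inputs]; omega
    · have := hf n (by omega)
      change f n + 2 + (m + 2 * n - f n) = m + 2 * (n + 1); omega

theorem IsTangle.caps (m : ℕ) (f : ℕ → ℕ) (n : ℕ) (hf : ∀ k < n, f k ≤ m + 2 * k) :
    IsTangle (m + 2 * n) ((List.range n).reverse.map fun k => ⟨.cap, f k⟩) m := by
  induction n with
  | zero => rfl
  | succ n ih =>
    rw [List.range_succ, List.reverse_append, List.map_append]
    refine IsTangle.append (m₂ := m + 2 * n) ⟨m + 2 * n - f n, ?_, ?_⟩
      (ih fun k hk => hf k (by omega))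
    · have := hf n (by omega)
      simp only [Piece.inputs]; omega
    · have := hf n (by omega)
      change f n + 0 + (m + 2 * n - f n) = m + 2 * n; omega

theorem IsTangle.crossings (m : ℕ) (l : List Slice)
    (hl : ∀ x ∈ l, (∃ s, x.piece = .cross s) ∧ x.pos + 2 ≤ m) : IsTangle m l m := by
  induction l with
  | nil => rfl
  | cons x l ih =>
    obtain ⟨⟨s, hs⟩, hx⟩ := hl x (by simp)
    refine ⟨m - (x.pos + 2), ?_, ?_⟩
    · rw [hs]; simp only [Piece.inputs]; omega
    · have e : x.pos + x.piece.outputs + (m - (x.pos + 2)) = m := by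
        rw [hs]; simp only [Piece.outputs]; omega
      rw [e]
      exact ih fun y hy => hl y (by simp [hy])

/-! ### Pretzel diagrams -/

/-- A vertical column of `|a|` crossings, all of the sign of `a`, on the strands `i` and `i + 1`. -/
def column (i : ℕ) (a : ℤ) : List Slice :=
  List.replicate a.natAbs ⟨.cross (decide (0 < a)), i⟩

/-- The slices of the pretzel diagram `P(a 1, …, a n)`: the columns of crossings `a 1, …, a n` stand
side by side from left to right, the `k`-th one on the strands `2 k - 2` and `2 k - 1`. At the bottom
and at the top, the right strand of each column is joined to the left strand of the next one, and
the left strand of the first column to the right strand of the last one by an outer arc. -/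
def pretzelSlices (n : ℕ) (a : ℕ → ℤ) : List Slice :=
  [⟨.cup, 0⟩] ++ ((List.range (n - 1)).map fun k => ⟨.cup, 2 * k + 1⟩) ++
    ((List.range n).flatMap fun k => column (2 * k) (a (k + 1))) ++
    ((List.range (n - 1)).reverse.map fun k => ⟨.cap, 2 * k + 1⟩) ++ [⟨.cap, 0⟩]

theorem pretzelSlices_isTangle (n : ℕ) (a : ℕ → ℤ) : IsTangle 0 (pretzelSlices n a) 0 := by
  have h₁ : IsTangle 0 [⟨.cup, 0⟩] 2 := ⟨0, rfl, rfl⟩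
  have h₂ := IsTangle.cups 2 (fun k => 2 * k + 1) (n - 1) (by intros; omega)
  have h₃ : IsTangle (2 + 2 * (n - 1))
      ((List.range n).flatMap fun k => column (2 * k) (a (k + 1))) (2 + 2 * (n - 1)) := by
    apply IsTangle.crossings
    intro x hx
    obtain ⟨k, hk, hx⟩ := List.mem_flatMap.1 hx
    rw [List.eq_of_mem_replicate hx]
    rw [List.mem_range] at hk
    exact ⟨⟨_, rfl⟩, by simp only; omega⟩
  have h₄ := IsTangle.caps 2 (fun k => 2 * k + 1) (n - 1) (by intros; omega)
  have h₅ : IsTangle 2 [⟨.cap, 0⟩] 0 := ⟨0, rfl, rfl⟩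
  exact (((h₁.append h₂).append h₃).append h₄).append h₅

/-- The pretzel diagram `P(a 1, …, a n)`, for `n ≥ 1`. -/
def pretzelDiagram (n : ℕ) (a : ℕ → ℤ) : LinkDiagram :=
  ⟨pretzelSlices n a, pretzelSlices_isTangle n a⟩

/-! ### Braid words and their closures

A braid word is coded by a list of non-zero integers: `m > 0` stands for `σ_m` and `-m` for
`σ_m⁻¹`. Its number of crossings is the length of the list. -/

/-- `w` is a braid word on `n` strands: its letters are `σ_i` or `σ_i⁻¹` with `1 ≤ i ≤ n - 1`. -/
def IsBraidWord (n : ℕ) (w : List ℤ) : Prop :=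
  ∀ m ∈ w, 1 ≤ m.natAbs ∧ m.natAbs + 1 ≤ n

/-- The slices of the closure of a braid word: the braid on the strands `0, …, n - 1` (the letter
`σ_i` crosses the `i`-th and the `(i + 1)`-st of them, which are numbered `i - 1` and `i`), whose
`k`-th end points at the bottom and at the top are joined by `n` parallel arcs running to the right
of the braid. -/
def closureSlices (n : ℕ) (w : List ℤ) : List Slice :=
  ((List.range n).map fun k => ⟨.cup, k⟩) ++
    (w.map fun m => ⟨.cross (decide (0 < m)), m.natAbs - 1⟩) ++
    ((List.range n).reverse.map fun k => ⟨.cap, k⟩)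

theorem closureSlices_isTangle (n : ℕ) (w : List ℤ) (hw : IsBraidWord n w) :
    IsTangle 0 (closureSlices n w) 0 := by
  have h₁ := IsTangle.cups 0 (fun k => k) n (by intros; omega)
  have h₂ : IsTangle (0 + 2 * n)
      (w.map fun m => ⟨.cross (decide (0 < m)), m.natAbs - 1⟩) (0 + 2 * n) := by
    apply IsTangle.crossings
    intro x hx
    obtain ⟨m, hm, rfl⟩ := List.mem_map.1 hx
    have := hw m hm
    exact ⟨⟨_, rfl⟩, by simp only; omega⟩
  have h₃ := IsTangle.caps 0 (fun k => k) n (by intros; omega)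
  exact (h₁.append h₂).append h₃

/-- The closure of a braid word on `n` strands. -/
def braidClosure (n : ℕ) (w : List ℤ) (hw : IsBraidWord n w) : LinkDiagram :=
  ⟨closureSlices n w, closureSlices_isTangle n w hw⟩

/-- The sequence `[i ↑ j] = (i, i + 1, …, j)` if `i ≤ j` and `i j > 0`; otherwise the empty word. -/
def ascending (i j : ℤ) : List ℤ :=
  if i ≤ j ∧ 0 < i * j then (List.range (j - i + 1).toNat).map fun k => i + (k : ℤ) else []

/-- The word `σ_i ^ a`, for `i ≥ 1`: `|a|` letters `σ_i` or `σ_i⁻¹`, according to the sign of `a`. -/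
def generatorPow (i a : ℤ) : List ℤ :=
  List.replicate a.natAbs (a.sign * i)

/-- The braid word
`[1 ↑ (n-2)] (n-1)^(a 1) (n-3)^(a 3) … 1^(a (n-1)) [-(n-2) ↑ -1] (n-1)^(a 2) (n-3)^(a 4) … 1^(a n)`,
for even `n`. -/
def evenPretzelBraid (n : ℕ) (a : ℕ → ℤ) : List ℤ :=
  ascending 1 ((n : ℤ) - 2) ++
    ((List.range (n / 2)).flatMap fun j : ℕ => generatorPow ((n : ℤ) - 1 - 2 * (j : ℤ)) (a (2 * j + 1))) ++
    ascending (-((n : ℤ) - 2)) (-1) ++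
    ((List.range (n / 2)).flatMap fun j : ℕ => generatorPow ((n : ℤ) - 1 - 2 * (j : ℤ)) (a (2 * j + 2)))

/-! Tangle diagrams are taken modulo local moves, so that a crossing on `m` strands is a unit
`sigma`. Every diagram in the argument has the form `closed y u`: a braid `u` on `2n` strands, with
a family `y` of minima below and the mirror image of `y` above. For a closed braid `y` is `n` nested
minima; for a pretzel diagram it is an outer minimum around `n - 1` minima side by side.

The given braid is `S A S⁻¹ B`, where `S` is one strand passing over `n - 2` others. The crossings
of `B` slide along the nested arcs to the right half of the strands (`cups_comp_sigma`), where they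
commute with `S`. What is left is the conjugate by `S` of a single row of `n` columns: the
odd-numbered ones in decreasing order, then the even-numbered ones in increasing order. Mirroring
inverts `S`, so the conjugation can be moved into `y` (`closed_comp`).

The row is then sorted column by column (`partlySorted_succ`). In state `j`, `j` minima stand side
by side inside the outer one, followed by `n - 1 - j` nested ones, and the strand `2j` passes over
the next `n - 1 - j` strands. Letting the pair `2j`, `2j + 1` pass over the columns to its right
brings column `j + 1` to place `j`. The passage of one strand of this pair is already present;
`closed_move_pair` trades it for the inverse passage of the other one. That inverse passage pulls
the left arm of the innermost nested minimum to the left, and `cups_comp_strandOver` makes it a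
separate minimum whose right arm passes over to the right: this is state `j + 1`. State `n - 2` is
the pretzel diagram up to one removable crossing. -/

theorem IsTangle.of_append {l₁ l₂ : List Slice} {m₁ m₃ : ℕ} (h : IsTangle m₁ (l₁ ++ l₂) m₃) :
    ∃ m₂, IsTangle m₁ l₁ m₂ ∧ IsTangle m₂ l₂ m₃ := by
  induction l₁ generalizing m₁ with
  | nil => exact ⟨m₁, rfl, h⟩
  | cons s l ih =>
    obtain ⟨r, hr, h⟩ := h
    obtain ⟨m₂, h₁, h₂⟩ := ih h
    exact ⟨m₂, ⟨r, hr, h₁⟩, h₂⟩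

/-! ### The quotient of tangle diagrams by the local moves -/

/-- Two tangle words differ by one local move. -/
def TangleStep (m m' : ℕ) (x y : {l : List Slice // IsTangle m l m'}) : Prop :=
  ∃ lower before after upper : List Slice, LocalMove before after ∧
    x.1 = lower ++ before ++ upper ∧ y.1 = lower ++ after ++ upper

/-- Tangles with `m` end points at the bottom and `m'` end points at the top, up to isotopy. -/
def Tangle (m m' : ℕ) : Type := Quot (TangleStep m m')

namespace Tangle

/-- The tangle of a diagram. -/
def mk {m m' : ℕ} (l : List Slice) (h : IsTangle m l m') : Tangle m m' := Quot.mk _ ⟨l, h⟩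

theorem mk_congr {m m' : ℕ} {l l' : List Slice} (e : l = l') (h : IsTangle m l m')
    (h' : IsTangle m l' m') : mk l h = mk l' h' := by
  subst e; rfl

/-- Stacking of tangles, the first one at the bottom. -/
def comp {a b c : ℕ} : Tangle a b → Tangle b c → Tangle a c :=
  Quot.map₂ (fun x y => ⟨x.1 ++ y.1, x.2.append y.2⟩)
    (by
      rintro x y y' ⟨lo, be, af, up, hm, h₁, h₂⟩
      exact ⟨x.1 ++ lo, be, af, up, hm, by simp [h₁], by simp [h₂]⟩)
    (by
      rintro x x' y ⟨lo, be, af, up, hm, h₁, h₂⟩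
      exact ⟨lo, be, af, up ++ y.1, hm, by simp [h₁], by simp [h₂]⟩)

theorem comp_assoc {a b c d : ℕ} (x : Tangle a b) (y : Tangle b c) (z : Tangle c d) :
    (x.comp y).comp z = x.comp (y.comp z) := by
  induction x using Quot.ind with | _ x =>
  induction y using Quot.ind with | _ y =>
  induction z using Quot.ind with | _ z =>
  exact mk_congr (List.append_assoc _ _ _) _ _

instance (m : ℕ) : Monoid (Tangle m m) where
  mul := comp
  one := mk [] rfl
  mul_assoc := comp_assoc
  one_mul x := by
    induction x using Quot.ind with | _ x => rfl
  mul_one x := by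
    induction x using Quot.ind with | _ x => exact mk_congr (List.append_nil _) _ _

theorem mul_def {m : ℕ} (x y : Tangle m m) : x * y = x.comp y := rfl

theorem comp_one {a b : ℕ} (x : Tangle a b) : x.comp 1 = x := by
  induction x using Quot.ind with | _ x => exact mk_congr (List.append_nil _) _ _

/-- Equality in a `Quot` is the equivalence relation generated by the steps, and for tangles without
end points these steps are the moves of link diagrams. -/
theorem sameLink {l l' : List Slice} (h : IsTangle 0 l 0) (h' : IsTangle 0 l' 0)
    (e : mk l h = mk l' h') : LinkDiagram.SameLink ⟨l, h⟩ ⟨l', h'⟩ := by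
  have key : ∀ x y : {l : List Slice // IsTangle 0 l 0}, Relation.EqvGen (TangleStep 0 0) x y →
      LinkDiagram.SameLink ⟨x.1, x.2⟩ ⟨y.1, y.2⟩ := by
    intro x y hxy
    induction hxy with
    | rel x y h => exact .rel _ _ h
    | refl x => exact .refl _
    | symm x y _ ih => exact .symm _ _ ih
    | trans x y z _ _ ih₁ ih₂ => exact .trans _ _ _ ih₁ ih₂
  exact key _ _ (Quot.eqvGen_exact e)

end Tangle

/-! ### Reflection in a horizontal line -/

/-- The mirror image of a piece in a horizontal line. -/
def Piece.flip : Piece → Piece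
  | .cup => .cap
  | .cap => .cup
  | .cross s => .cross (!s)

theorem Piece.inputs_flip (p : Piece) : p.flip.inputs = p.outputs := by cases p <;> rfl

theorem Piece.outputs_flip (p : Piece) : p.flip.outputs = p.inputs := by cases p <;> rfl

/-- The mirror image of a slice in a horizontal line. -/
def Slice.flip (s : Slice) : Slice := ⟨s.piece.flip, s.pos⟩

/-- The mirror image of a tangle diagram in a horizontal line. -/
def flipSlices (l : List Slice) : List Slice := (l.map Slice.flip).reverse

theorem flipSlices_append (l l' : List Slice) :
    flipSlices (l ++ l') = flipSlices l' ++ flipSlices l := by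
  simp [flipSlices]

theorem IsTangle.flip {l : List Slice} {m m' : ℕ} (h : IsTangle m l m') :
    IsTangle m' (flipSlices l) m := by
  induction l generalizing m with
  | nil => exact Eq.symm h
  | cons s l ih =>
    obtain ⟨r, hr, h⟩ := h
    have : flipSlices (s :: l) = flipSlices l ++ [s.flip] := by simp [flipSlices]
    rw [this]
    refine (ih h).append ⟨r, ?_, ?_⟩
    · simp [Slice.flip, Piece.inputs_flip]
    · simp only [Slice.flip, Piece.outputs_flip, hr]
      rfl

/-- Mirroring permutes the types of moves. Only the exchange of heights comes out in the reverse
direction, hence the disjunction. -/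
theorem LocalMove.flip {l l' : List Slice} (h : LocalMove l l') :
    LocalMove (flipSlices l) (flipSlices l') ∨ LocalMove (flipSlices l') (flipSlices l) := by
  cases h with
  | exchange p q i k =>
    right
    have := LocalMove.exchange p.flip q.flip i k
    rw [Piece.inputs_flip, Piece.outputs_flip] at this
    exact this
  | zigzag_left i => exact .inl (.zigzag_right i)
  | zigzag_right i => exact .inl (.zigzag_left i)
  | turn_cup s i => exact .inl (.turn_cap (!s) i)
  | turn_cap s i => exact .inl (.turn_cup (!s) i)
  | reidemeister_one_cup s i => exact .inl (.reidemeister_one_cap (!s) i)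
  | reidemeister_one_cap s i => exact .inl (.reidemeister_one_cup (!s) i)
  | reidemeister_two s i =>
    have := LocalMove.reidemeister_two (!(!s)) i
    rw [Bool.not_not (!s)] at this
    exact .inl this
  | reidemeister_three s i => exact .inl (.reidemeister_three (!s) i)

namespace Tangle

/-- The mirror image of a tangle in a horizontal line. -/
def flip {m m' : ℕ} : Tangle m m' → Tangle m' m :=
  Quot.lift (fun x => mk (flipSlices x.1) x.2.flip) (by
    rintro x y ⟨lo, be, af, up, hm, h₁, h₂⟩
    have e (z : List Slice) : flipSlices (lo ++ z ++ up) =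
        flipSlices up ++ flipSlices z ++ flipSlices lo := by
      simp [flipSlices_append]
    rcases hm.flip with hm | hm
    · exact Quot.sound ⟨_, _, _, _, hm, (congrArg flipSlices h₁).trans (e _),
        (congrArg flipSlices h₂).trans (e _)⟩
    · exact (Quot.sound ⟨_, _, _, _, hm, (congrArg flipSlices h₂).trans (e _),
        (congrArg flipSlices h₁).trans (e _)⟩).symm)

theorem flip_mk {m m' : ℕ} {l : List Slice} (h : IsTangle m l m') :
    (mk l h).flip = mk (flipSlices l) h.flip := rfl

theorem flip_comp {a b c : ℕ} (x : Tangle a b) (y : Tangle b c) :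
    (x.comp y).flip = y.flip.comp x.flip := by
  induction x using Quot.ind with | _ x =>
  induction y using Quot.ind with | _ y =>
  exact mk_congr (flipSlices_append _ _) _ _

end Tangle

/-! ### Isotopic tangle words -/

/-- `Isotopic l l'`: whatever the number of strands at the bottom, the words `l` and `l'` describe
the same tangle. -/
def Isotopic (l l' : List Slice) : Prop :=
  ∀ m m', (IsTangle m l m' ↔ IsTangle m l' m') ∧
    ∀ (h : IsTangle m l m') (h' : IsTangle m l' m'), Tangle.mk l h = Tangle.mk l' h'

namespace Isotopic

theorem refl (l : List Slice) : Isotopic l l := fun _ _ => ⟨Iff.rfl, fun _ _ => rfl⟩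

theorem symm {l l' : List Slice} (h : Isotopic l l') : Isotopic l' l :=
  fun m m' => ⟨(h m m').1.symm, fun h₁ h₂ => ((h m m').2 h₂ h₁).symm⟩

theorem trans {l l' l'' : List Slice} (h : Isotopic l l') (h' : Isotopic l' l'') :
    Isotopic l l'' := fun m m' =>
  ⟨(h m m').1.trans (h' m m').1, fun h₁ h₂ =>
    ((h m m').2 h₁ ((h m m').1.1 h₁)).trans ((h' m m').2 _ h₂)⟩

theorem append {l₁ l₁' l₂ l₂' : List Slice} (h₁ : Isotopic l₁ l₁') (h₂ : Isotopic l₂ l₂') :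
    Isotopic (l₁ ++ l₂) (l₁' ++ l₂') := by
  intro m m'
  have e : IsTangle m (l₁ ++ l₂) m' ↔ IsTangle m (l₁' ++ l₂') m' := by
    constructor
    · intro h
      obtain ⟨k, a, b⟩ := h.of_append
      exact ((h₁ _ _).1.1 a).append ((h₂ _ _).1.1 b)
    · intro h
      obtain ⟨k, a, b⟩ := h.of_append
      exact ((h₁ _ _).1.2 a).append ((h₂ _ _).1.2 b)
  refine ⟨e, fun h h' => ?_⟩
  obtain ⟨k, a, b⟩ := h.of_append
  have a' := (h₁ _ _).1.1 a
  have b' := (h₂ _ _).1.1 b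
  change (Tangle.mk l₁ a).comp (Tangle.mk l₂ b) = (Tangle.mk l₁' a').comp (Tangle.mk l₂' b')
  rw [(h₁ _ _).2 a a', (h₂ _ _).2 b b']

theorem append_left (l : List Slice) {l₁ l₂ : List Slice} (h : Isotopic l₁ l₂) :
    Isotopic (l ++ l₁) (l ++ l₂) := (refl l).append h

theorem append_right (l : List Slice) {l₁ l₂ : List Slice} (h : Isotopic l₁ l₂) :
    Isotopic (l₁ ++ l) (l₂ ++ l) := h.append (refl l)

/-- A local move does not record the number of strands, so well-formedness of the two sides has to
be compared separately. -/
theorem of_localMove {l l' : List Slice} (h : LocalMove l l')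
    (e : ∀ m m', IsTangle m l m' ↔ IsTangle m l' m') : Isotopic l l' := fun m m' =>
  ⟨e m m', fun _ _ => Quot.sound ⟨[], l, l', [], h, by simp, by simp⟩⟩

theorem exchange (p q : Piece) (i k : ℕ) :
    Isotopic [⟨q, i + p.inputs + k⟩, ⟨p, i⟩] [⟨p, i⟩, ⟨q, i + p.outputs + k⟩] := by
  refine of_localMove (.exchange p q i k) fun m m' => ?_
  simp only [IsTangle]
  constructor
  · rintro ⟨r, h₁, r', h₂, h₃⟩
    exact ⟨k + q.inputs + r, by omega, r, by omega, by omega⟩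
  · rintro ⟨r, h₁, r', h₂, h₃⟩
    exact ⟨r', by omega, k + q.outputs + r', by omega, by omega⟩

theorem turn_cup (s : Bool) (i : ℕ) :
    Isotopic [⟨.cup, i + 1⟩, ⟨.cross s, i⟩] [⟨.cup, i⟩, ⟨.cross (!s), i + 1⟩] := by
  refine of_localMove (.turn_cup s i) fun m m' => ?_
  simp only [IsTangle, Piece.inputs, Piece.outputs]
  constructor
  · rintro ⟨r, h₁, r', h₂, h₃⟩
    exact ⟨r + 1, by omega, r, by omega, by omega⟩
  · rintro ⟨r, h₁, r', h₂, h₃⟩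
    exact ⟨r', by omega, r' + 1, by omega, by omega⟩

theorem curl (s : Bool) (i : ℕ) : Isotopic [⟨.cup, i⟩, ⟨.cross s, i⟩] [⟨.cup, i⟩] := by
  refine of_localMove (.reidemeister_one_cup s i) fun m m' => ?_
  simp only [IsTangle, Piece.inputs, Piece.outputs]
  constructor
  · rintro ⟨r, h₁, r', h₂, h₃⟩
    exact ⟨r, by omega, by omega⟩
  · rintro ⟨r, h₁, h₃⟩
    exact ⟨r, by omega, r, by omega, by omega⟩

/-- A crossing is moved down past pieces on its right. -/
theorem cross_comm (s : Bool) (i : ℕ) (l : List Slice) (hl : ∀ x ∈ l, i + 2 ≤ x.pos) :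
    Isotopic (l ++ [⟨.cross s, i⟩]) (⟨.cross s, i⟩ :: l) := by
  induction l with
  | nil => exact refl _
  | cons x l ih =>
    have h₁ := (ih fun y hy => hl y (by simp [hy])).append_left [x]
    obtain ⟨k, hk⟩ := Nat.exists_eq_add_of_le (hl x (by simp))
    have h₂ := (exchange (.cross s) x.piece i k).append_right l
    simp only [Piece.inputs, Piece.outputs, ← hk] at h₂
    exact h₁.trans h₂

end Isotopic

/-! ### Braids as invertible tangles -/

namespace Tangle

theorem isTangle_cross {m i : ℕ} (h : i + 2 ≤ m) (s : Bool) :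
    IsTangle m [⟨.cross s, i⟩] m :=
  ⟨m - (i + 2), by simp only [Piece.inputs]; omega, by
    change i + 2 + (m - (i + 2)) = m; omega⟩

theorem mk_cross_mul_mk_cross {m i : ℕ} (h : i + 2 ≤ m) (s : Bool) :
    mk _ (isTangle_cross h s) * mk _ (isTangle_cross h (!s)) = 1 :=
  Quot.sound ⟨[], _, _, [], .reidemeister_two s i, rfl, rfl⟩

open Classical in
/-- The braid generator crossing the strands `i` and `i + 1` out of `m`; it is trivial if there are
no such strands. -/
noncomputable def sigma (m i : ℕ) : (Tangle m m)ˣ :=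
  if h : i + 2 ≤ m then
    ⟨mk _ (isTangle_cross h true), mk _ (isTangle_cross h false), mk_cross_mul_mk_cross h true,
      mk_cross_mul_mk_cross h false⟩
  else 1

theorem val_sigma {m i : ℕ} (h : i + 2 ≤ m) :
    (sigma m i : Tangle m m) = mk _ (isTangle_cross h true) := by
  rw [sigma, dif_pos h]

theorem val_sigma_inv {m i : ℕ} (h : i + 2 ≤ m) :
    ((sigma m i)⁻¹ : (Tangle m m)ˣ).val = mk _ (isTangle_cross h false) := by
  rw [sigma, dif_pos h]; rfl

theorem sigma_comm {m i j : ℕ} (h : i + 2 ≤ j) : Commute (sigma m i) (sigma m j) := by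
  by_cases hj : j + 2 ≤ m
  · have hi : i + 2 ≤ m := by omega
    apply Units.ext
    rw [Units.val_mul, Units.val_mul, val_sigma hi, val_sigma hj]
    refine (((Isotopic.cross_comm true i [⟨.cross true, j⟩] ?_) _ _).2 _ _).symm
    simpa using h
  · rw [sigma.eq_def m j, dif_neg hj]
    exact Commute.one_right _

theorem sigma_comm' {m i j : ℕ} (h : i + 2 ≤ j ∨ j + 2 ≤ i) :
    Commute (sigma m i) (sigma m j) :=
  h.elim sigma_comm fun h => (sigma_comm h).symm

theorem sigma_braid {m i : ℕ} (h : i + 3 ≤ m) :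
    sigma m i * sigma m (i + 1) * sigma m i = sigma m (i + 1) * sigma m i * sigma m (i + 1) := by
  apply Units.ext
  simp only [Units.val_mul]
  rw [val_sigma (i := i) (by omega), val_sigma (i := i + 1) (by omega)]
  exact Quot.sound ⟨[], _, _, [], .reidemeister_three true i, rfl, rfl⟩

/-- Mirroring in a horizontal line inverts this braid. -/
def FlipsToInv {m : ℕ} (u : (Tangle m m)ˣ) : Prop := u.val.flip = (u⁻¹).val

theorem FlipsToInv.mul {m : ℕ} {u v : (Tangle m m)ˣ} (hu : FlipsToInv u) (hv : FlipsToInv v) :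
    FlipsToInv (u * v) := by
  unfold FlipsToInv at *
  rw [mul_inv_rev, Units.val_mul, Units.val_mul, mul_def, flip_comp, hu, hv, mul_def]

theorem flipsToInv_one (m : ℕ) : FlipsToInv (1 : (Tangle m m)ˣ) := rfl

theorem flipsToInv_sigma (m i : ℕ) : FlipsToInv (sigma m i) := by
  by_cases h : i + 2 ≤ m
  · unfold FlipsToInv
    rw [val_sigma h, val_sigma_inv h]
    rfl
  · rw [sigma, dif_neg h]
    exact flipsToInv_one m

/-- Mirroring `u * u⁻¹ = 1` shows that the mirror image of `u⁻¹` is a left inverse of `u⁻¹`. -/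
theorem FlipsToInv.inv {m : ℕ} {u : (Tangle m m)ˣ} (hu : FlipsToInv u) : FlipsToInv u⁻¹ := by
  unfold FlipsToInv at *
  have h₁ : (u.val * (u⁻¹).val).flip = 1 := by rw [Units.mul_inv]; rfl
  rw [mul_def, flip_comp, ← mul_def, hu] at h₁
  rw [inv_inv]
  exact Units.mul_eq_one_iff_eq_inv.1 h₁

/-! ### Strands and pairs of strands passing over others -/

/-- The strand `p` moves over `k` strands to the right. -/
noncomputable def strandOver (m p k : ℕ) : (Tangle m m)ˣ :=
  ((List.range k).map fun t => sigma m (p + t)).prod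

theorem strandOver_zero (m p : ℕ) : strandOver m p 0 = 1 := rfl

theorem strandOver_succ (m p k : ℕ) : strandOver m p (k + 1) = strandOver m p k * sigma m (p + k) := by
  simp [strandOver, List.range_succ]

theorem flipsToInv_strandOver (m p k : ℕ) : FlipsToInv (strandOver m p k) := by
  induction k with
  | zero => exact flipsToInv_one m
  | succ k ih => rw [strandOver_succ]; exact ih.mul (flipsToInv_sigma m _)

theorem sigma_comm_strandOver {m i p k : ℕ} (h : i + 2 ≤ p ∨ p + k + 1 ≤ i) :
    Commute (sigma m i) (strandOver m p k) := by
  induction k with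
  | zero => exact Commute.one_right _
  | succ k ih =>
    rw [strandOver_succ]
    exact (ih (by omega)).mul_right (sigma_comm' (by omega))

/-- A crossing slides under a strand moving over it. -/
theorem strandOver_semiconj {m p k q : ℕ} (h₁ : p ≤ q) (h₂ : q + 2 ≤ p + k) (h₃ : p + k + 1 ≤ m) :
    SemiconjBy (strandOver m p k) (sigma m q) (sigma m (q + 1)) := by
  induction k with
  | zero => omega
  | succ k ih =>
    rw [strandOver_succ]
    rcases Nat.lt_or_ge (q + 1) (p + k) with h | h
    -- The last crossing of the strand is far from the sliding one and commutes with it.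
    · exact (ih (by omega) (by omega)).mul_left (sigma_comm' (by omega))
    -- Otherwise the sliding crossing meets the last two crossings of the strand in a Reidemeister
    -- III triangle.
    · obtain ⟨k, rfl⟩ : ∃ k', k = k' + 1 := ⟨k - 1, by omega⟩
      obtain rfl : q = p + k := by omega
      rw [strandOver_succ]
      have hb := sigma_braid (m := m) (i := p + k) (by omega)
      have hc := sigma_comm_strandOver (m := m) (i := p + k + 1) (p := p) (k := k) (by omega)
      have e : p + (k + 1) = p + k + 1 := rfl
      rw [e]
      unfold SemiconjBy
      calc strandOver m p k * sigma m (p + k) * sigma m (p + k + 1) * sigma m (p + k)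
          = strandOver m p k * (sigma m (p + k) * sigma m (p + k + 1) * sigma m (p + k)) := by group
        _ = strandOver m p k * sigma m (p + k + 1) * (sigma m (p + k) * sigma m (p + k + 1)) := by
            rw [hb]; group
        _ = _ := by rw [← hc.eq]; group

/-- The pair of strands `p`, `p + 1` moves over `k` strands to the right. -/
noncomputable def pairOver (m p k : ℕ) : (Tangle m m)ˣ := strandOver m (p + 1) k * strandOver m p k

theorem pairOver_comm {m i p k : ℕ} (h : i + 2 ≤ p ∨ p + k + 2 ≤ i) :
    Commute (pairOver m p k) (sigma m i) :=
  ((sigma_comm_strandOver (by omega)).mul_right (sigma_comm_strandOver (by omega))).symm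

/-- Each of the two strands shifts the crossing below it by one place. -/
theorem pairOver_semiconj {m p k q : ℕ} (h₁ : p + 2 ≤ q) (h₂ : q ≤ p + k) (h₃ : p + k + 2 ≤ m) :
    SemiconjBy (pairOver m p k) (sigma m (q - 2)) (sigma m q) := by
  obtain ⟨q, rfl⟩ := Nat.exists_eq_add_of_le' (le_trans (Nat.le_add_left 2 p) h₁)
  exact (strandOver_semiconj (q := q + 1) (by omega) (by omega) (by omega)).mul_left
    (strandOver_semiconj (q := q) (by omega) (by omega) (by omega))

/-- A crossing between the two strands of the pair travels along with the pair. By induction it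
suffices to pass one further strand, which is the braid relation. -/
theorem pairOver_semiconj_pair {m p k : ℕ} (h : p + k + 2 ≤ m) :
    SemiconjBy (pairOver m p k) (sigma m (p + k)) (sigma m p) := by
  induction k with
  | zero => exact SemiconjBy.one_left _
  | succ k ih =>
    have hb := sigma_braid (m := m) (i := p + k) (by omega)
    have hc := sigma_comm_strandOver (m := m) (i := p + k + 1) (p := p) (k := k) (by omega)
    have e : pairOver m p (k + 1) =
        pairOver m p k * (sigma m (p + k + 1) * sigma m (p + k)) := by
      rw [pairOver, strandOver_succ, strandOver_succ, pairOver, show p + 1 + k = p + k + 1 by omega]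
      simp only [mul_assoc]
      rw [← mul_assoc (sigma m (p + k + 1)) (strandOver m p k), hc.eq, mul_assoc]
    rw [e]
    refine (ih (by omega)).mul_left ?_
    change _ * sigma m (p + k + 1) = _
    rw [← hb, mul_assoc]

end Tangle

/-! ### Subgroups of braids: inverted by mirroring, absorbed by minima -/

namespace Tangle

/-- The braids that are inverted by mirroring in a horizontal line. -/
def flipSubgroup (m : ℕ) : Subgroup (Tangle m m)ˣ where
  carrier := {u | FlipsToInv u}
  mul_mem' := FlipsToInv.mul
  one_mem' := flipsToInv_one m
  inv_mem' := FlipsToInv.inv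

/-- The braids that can be absorbed by the tangle `y` below them. -/
def absorbed {k m : ℕ} (y : Tangle k m) : Subgroup (Tangle m m)ˣ where
  carrier := {u | y.comp u.val = y}
  mul_mem' {u v} hu hv := by
    change y.comp (u.val.comp v.val) = y
    rw [← comp_assoc, hu, hv]
  one_mem' := comp_one y
  inv_mem' {u} hu := by
    change y.comp (u⁻¹).val = y
    conv_lhs => rw [← (hu : y.comp u.val = y)]
    rw [comp_assoc, ← mul_def, Units.mul_inv, comp_one]

theorem comp_mul {k m : ℕ} (y : Tangle k m) (u v : (Tangle m m)ˣ) :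
    y.comp (u * v).val = (y.comp u.val).comp v.val :=
  (comp_assoc y u.val v.val).symm

/-! ### Words for braids -/

/-- The word `l` describes the braid `u`. -/
def Represents {m : ℕ} (l : List Slice) (u : (Tangle m m)ˣ) : Prop :=
  ∃ h : IsTangle m l m, mk l h = u.val

namespace Represents

variable {m : ℕ}

theorem nil : Represents [] (1 : (Tangle m m)ˣ) := ⟨rfl, rfl⟩

theorem append {l l' : List Slice} {u v : (Tangle m m)ˣ} (h : Represents l u)
    (h' : Represents l' v) : Represents (l ++ l') (u * v) := by
  obtain ⟨h, e⟩ := h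
  obtain ⟨h', e'⟩ := h'
  exact ⟨h.append h', by rw [Units.val_mul, ← e, ← e']; rfl⟩

theorem flip {l : List Slice} {u : (Tangle m m)ˣ} (h : Represents l u) (hu : FlipsToInv u) :
    Represents (flipSlices l) u⁻¹ := by
  obtain ⟨h, e⟩ := h
  exact ⟨h.flip, by rw [← flip_mk h, e]; exact hu⟩

theorem flatMap_range (N : ℕ) {f : ℕ → List Slice} {u : ℕ → (Tangle m m)ˣ}
    (h : ∀ k < N, Represents (f k) (u k)) :
    Represents ((List.range N).flatMap f) ((List.range N).map u).prod := by
  induction N with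
  | zero => exact nil
  | succ N ih =>
    have := (ih fun k hk => h k (by omega)).append (h N (by omega))
    simpa [List.range_succ] using this

theorem sigma {i : ℕ} (h : i + 2 ≤ m) :
    Represents [⟨.cross true, i⟩] (Tangle.sigma m i) :=
  ⟨isTangle_cross h true, (val_sigma h).symm⟩

theorem sigma_inv {i : ℕ} (h : i + 2 ≤ m) :
    Represents [⟨.cross false, i⟩] (Tangle.sigma m i)⁻¹ :=
  ⟨isTangle_cross h false, (val_sigma_inv h).symm⟩

theorem replicate {l : Slice} {u : (Tangle m m)ˣ} (h : Represents [l] u) (N : ℕ) :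
    Represents (List.replicate N l) (u ^ N) := by
  induction N with
  | zero => exact nil
  | succ N ih => rw [pow_succ, List.replicate_succ']; exact ih.append h

theorem column {i : ℕ} (h : i + 2 ≤ m) (a : ℤ) :
    Represents (column i a) (Tangle.sigma m i ^ a) := by
  unfold _root_.column
  rcases lt_or_ge 0 a with ha | ha
  · rw [decide_eq_true ha]
    have := (sigma h).replicate a.natAbs
    rwa [← zpow_natCast, Int.natAbs_of_nonneg ha.le] at this
  · rw [decide_eq_false (not_lt.2 ha)]
    have := (sigma_inv h).replicate a.natAbs
    rwa [inv_pow, ← zpow_natCast, Int.ofNat_natAbs_of_nonpos ha, zpow_neg, inv_inv] at this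

end Represents

end Tangle

/-- The slices of a strand moving over `k` strands to the right, from the position `p`. -/
def strandOverSlices (p k : ℕ) : List Slice := (List.range k).map fun t => ⟨.cross true, p + t⟩

theorem strandOverSlices_succ (p k : ℕ) :
    strandOverSlices p (k + 1) = ⟨.cross true, p⟩ :: strandOverSlices (p + 1) k := by
  simp only [strandOverSlices, List.range_succ_eq_map, List.map_cons, List.map_map]
  congr 2
  funext t
  simp only [Function.comp]
  congr 1; omega

theorem Tangle.Represents.strandOver {m p k : ℕ} (h : p + k + 1 ≤ m ∨ k = 0) :
    Represents (strandOverSlices p k) (Tangle.strandOver m p k) := by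
  have := flatMap_range (m := m) k (f := fun t => [⟨.cross true, p + t⟩])
    (u := fun t => Tangle.sigma m (p + t)) fun t ht => sigma (by omega)
  rwa [← List.map_eq_flatMap] at this

/-! ### Families of minima -/

/-- The slices of `k` nested minima, the outermost one beginning at the position `i`. -/
def nestedCups (i k : ℕ) : List Slice := (List.range k).map fun t => ⟨.cup, i + t⟩

theorem nestedCups_succ (i k : ℕ) :
    nestedCups i (k + 1) = ⟨.cup, i⟩ :: nestedCups (i + 1) k := by
  simp only [nestedCups, List.range_succ_eq_map, List.map_cons, List.map_map]
  congr 2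
  funext t
  simp only [Function.comp]
  congr 1; omega

theorem nestedCups_succ' (i k : ℕ) :
    nestedCups i (k + 1) = nestedCups i k ++ [⟨.cup, i + k⟩] := by
  simp [nestedCups, List.range_succ]

theorem nestedCups_add (i k l : ℕ) :
    nestedCups i (k + l) = nestedCups i k ++ nestedCups (i + k) l := by
  induction l with
  | zero => simp [nestedCups]
  | succ l ih => rw [← add_assoc, nestedCups_succ', ih, nestedCups_succ', List.append_assoc, add_assoc]

theorem le_pos_of_mem_nestedCups {i k : ℕ} {x : Slice} (hx : x ∈ nestedCups i k) : i ≤ x.pos := by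
  obtain ⟨t, -, rfl⟩ := List.mem_map.1 hx
  simp

theorem le_pos_of_mem_strandOverSlices {i k : ℕ} {x : Slice} (hx : x ∈ strandOverSlices i k) :
    i ≤ x.pos := by
  obtain ⟨t, -, rfl⟩ := List.mem_map.1 hx
  simp

namespace Isotopic

/-- The innermost of `k + 1` nested minima has its left arm pulled over to the left; it is made a
separate minimum, whose right arm is pulled over to the right. -/
theorem pull_inner_cup (i k : ℕ) :
    Isotopic (nestedCups i (k + 1) ++ flipSlices (strandOverSlices i k))
      (⟨.cup, i⟩ :: nestedCups (i + 2) k ++ strandOverSlices (i + 1) k) := by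
  induction k generalizing i with
  | zero => exact refl _
  | succ k ih =>
    -- The first `k` crossings happen inside the outermost minimum and are handled by induction; the
    -- crossing with its left arm remains.
    have h₁ : Isotopic (nestedCups i (k + 2) ++ flipSlices (strandOverSlices i (k + 1)))
        ([⟨.cup, i⟩, ⟨.cup, i + 1⟩] ++
          ((nestedCups (i + 3) k ++ strandOverSlices (i + 2) k) ++ [⟨.cross false, i⟩])) := by
      have := ((ih (i + 1)).append_left [⟨.cup, i⟩]).append_right [⟨.cross false, i⟩]
      have e : flipSlices (strandOverSlices i (k + 1)) =
          flipSlices (strandOverSlices (i + 1) k) ++ [⟨.cross false, i⟩] := by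
        rw [strandOverSlices_succ]
        exact flipSlices_append [_] _
      rw [nestedCups_succ, e]
      simpa [add_assoc] using this
    have h₂ := (cross_comm false i (nestedCups (i + 3) k ++ strandOverSlices (i + 2) k)
      fun x hx => by
        rcases List.mem_append.1 hx with hx | hx
        · have := le_pos_of_mem_nestedCups hx; omega
        · have := le_pos_of_mem_strandOverSlices hx; omega).append_left
      [⟨.cup, i⟩, ⟨.cup, i + 1⟩]
    -- Turning the remaining crossing about the separated minimum puts that minimum to the left of
    -- the outermost one. The changed sign makes it the first crossing of the right arm's passage.
    have h₃ := ((turn_cup false i).append_left [⟨.cup, i⟩]).append_right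
      (nestedCups (i + 3) k ++ strandOverSlices (i + 2) k)
    have h₄ := (exchange .cup .cup i 0).append_right
      (⟨.cross true, i + 1⟩ :: (nestedCups (i + 3) k ++ strandOverSlices (i + 2) k))
    have h₅ := (((cross_comm true (i + 1) (nestedCups (i + 3) k) fun x hx => by
      have := le_pos_of_mem_nestedCups hx; omega).symm).append_left
        [⟨.cup, i⟩, ⟨.cup, i + 2⟩]).append_right (strandOverSlices (i + 2) k)
    refine h₁.trans (h₂.trans (Isotopic.trans ?_ (h₄.trans (Isotopic.trans ?_ (h₅.trans ?_)))))
    · simpa [Piece.inputs] using h₃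
    · simpa [Piece.outputs] using refl _
    · rw [nestedCups_succ, strandOverSlices_succ (i + 1)]
      simpa using refl _

/-- Each of the `k` minima inserts two strands to the left of the crossing. -/
theorem cross_nestedCups (s : Bool) (i j k : ℕ) :
    Isotopic (⟨.cross s, i + j⟩ :: nestedCups i k)
      (nestedCups i k ++ [⟨.cross s, i + j + 2 * k⟩]) := by
  induction k generalizing i j with
  | zero => exact refl _
  | succ k ih =>
    have h₁ := (exchange .cup (.cross s) i j).append_right (nestedCups (i + 1) k)
    have h₂ := (ih (i + 1) (j + 1)).append_left [⟨.cup, i⟩]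
    rw [nestedCups_succ]
    simp only [Piece.inputs, Piece.outputs, add_zero] at h₁
    refine h₁.trans ?_
    rw [show i + 2 + j = i + 1 + (j + 1) by omega]
    refine h₂.trans ?_
    rw [show i + 1 + (j + 1) + 2 * k = i + j + 2 * (k + 1) by omega]
    exact refl _

/-- A crossing of the left arms of two nested minima is moved to their right arms. -/
theorem fold (s : Bool) (j k : ℕ) :
    Isotopic (nestedCups 0 (j + 2 + k) ++ [⟨.cross s, j⟩])
      (nestedCups 0 (j + 2 + k) ++ [⟨.cross s, j + 2 + 2 * k⟩]) := by
  have h₁ := (cross_comm s j (nestedCups (j + 2) k) fun x hx => by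
    have := le_pos_of_mem_nestedCups hx; omega).append_left [⟨.cup, j⟩, ⟨.cup, j + 1⟩]
  -- One turn about each of the two minima; the two sign changes cancel.
  have h₂ : Isotopic [⟨.cup, j⟩, ⟨.cup, j + 1⟩, ⟨.cross s, j⟩]
      [⟨.cup, j⟩, ⟨.cup, j + 1⟩, ⟨.cross s, j + 2⟩] := by
    have a₁ := (turn_cup s j).append_left [⟨.cup, j⟩]
    have a₂ := (exchange .cup .cup j 0).append_right [⟨.cross (!s), j + 1⟩]
    have a₃ := (turn_cup (!s) (j + 1)).append_left [⟨.cup, j⟩]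
    rw [Bool.not_not] at a₃
    exact a₁.trans (a₂.trans a₃)
  have h₃ := (cross_nestedCups s (j + 2) 0 k).append_left [⟨.cup, j⟩, ⟨.cup, j + 1⟩]
  have h₄ := (h₁.trans ((h₂.append_right (nestedCups (j + 2) k)).trans h₃)).append_left
    (nestedCups 0 j)
  have e : nestedCups 0 (j + 2 + k) =
      nestedCups 0 j ++ ([⟨.cup, j⟩, ⟨.cup, j + 1⟩] ++ nestedCups (j + 2) k) := by
    rw [nestedCups_add, nestedCups_add, zero_add, zero_add, List.append_assoc]
    rfl
  rw [e]
  simpa using h₄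

end Isotopic

/-! ### The cup states between a closed braid and a pretzel diagram -/

/-- The minima of a link diagram which is a pretzel diagram outside of `r` nested circles: an outer
minimum, which contains `j` minima side by side and then `r` nested ones. -/
def cupSlices (j r : ℕ) : List Slice :=
  [⟨.cup, 0⟩] ++ ((List.range j).map fun k => ⟨.cup, 2 * k + 1⟩) ++ nestedCups (2 * j + 1) r

theorem isTangle_cupSlices (j r : ℕ) : IsTangle 0 (cupSlices j r) (2 + 2 * j + 2 * r) := by
  have h₁ : IsTangle 0 [⟨.cup, 0⟩] 2 := ⟨0, rfl, rfl⟩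
  have h₂ := IsTangle.cups 2 (fun k => 2 * k + 1) j (by intros; omega)
  have h₃ := IsTangle.cups (2 + 2 * j) (fun k => 2 * j + 1 + k) r (by intros; omega)
  exact (h₁.append h₂).append h₃

theorem cupSlices_succ (j r : ℕ) :
    cupSlices (j + 1) r = cupSlices j 0 ++ ⟨.cup, 2 * j + 1⟩ :: nestedCups (2 * j + 3) r := by
  simp [cupSlices, List.range_succ, nestedCups, mul_add, add_assoc]

theorem cupSlices_eq_append (j r : ℕ) :
    cupSlices j r = cupSlices j 0 ++ nestedCups (2 * j + 1) r := by
  simp [cupSlices, nestedCups]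

theorem cupSlices_zero (r : ℕ) : cupSlices 0 r = nestedCups 0 (r + 1) := by
  rw [nestedCups_succ]; rfl

namespace Tangle

/-- The tangle of `cupSlices`. -/
def cups (m j r : ℕ) (h : 2 + 2 * j + 2 * r = m) : Tangle 0 m :=
  mk (cupSlices j r) (h ▸ isTangle_cupSlices j r)

theorem comp_eq_of_isotopic {m a : ℕ} {l l' w w' : List Slice} {u u' : (Tangle m m)ˣ}
    (h : IsTangle a l m) (h' : IsTangle a l' m) (hw : Represents w u) (hw' : Represents w' u')
    (e : Isotopic (l ++ w) (l' ++ w')) : (mk l h).comp u.val = (mk l' h').comp u'.val := by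
  obtain ⟨hw, eu⟩ := hw
  obtain ⟨hw', eu'⟩ := hw'
  rw [← eu, ← eu']
  exact (e _ _).2 (h.append hw) (h'.append hw')

theorem cups_comp_strandOver {m j r : ℕ} (h : 2 + 2 * j + 2 * (r + 1) = m) :
    (cups m j (r + 1) h).comp ((strandOver m (2 * j + 1) r)⁻¹).val =
      (cups m (j + 1) r (by omega)).comp (strandOver m (2 * j + 2) r).val := by
  refine comp_eq_of_isotopic _ _
    ((Represents.strandOver (by omega)).flip (flipsToInv_strandOver _ _ _))
    (Represents.strandOver (by omega)) ?_
  rw [cupSlices_eq_append, cupSlices_succ, List.append_assoc, List.append_assoc]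
  exact (Isotopic.pull_inner_cup (2 * j + 1) r).append_left _

/-- The crossing joins the two arms of the innermost minimum, so it is a curl. -/
theorem sigma_mem_absorbed_cups {m j r : ℕ} (h : 2 + 2 * j + 2 * (r + 1) = m) :
    sigma m (2 * j + 1 + r) ∈ absorbed (cups m j (r + 1) h) := by
  have := comp_eq_of_isotopic (h ▸ isTangle_cupSlices j (r + 1))
    (h ▸ isTangle_cupSlices j (r + 1)) (Represents.sigma (i := 2 * j + 1 + r) (by omega))
    (Represents.nil) (by
      rw [cupSlices_eq_append, nestedCups_succ']
      simpa using (Isotopic.curl true (2 * j + 1 + r)).append_left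
        (cupSlices j 0 ++ nestedCups (2 * j + 1) r))
  exact this.trans (comp_one _)

theorem cups_comp_sigma {m j k : ℕ} (h : 2 + 2 * 0 + 2 * (j + 1 + k) = m) :
    (cups m 0 (j + 1 + k) h).comp (sigma m j).val =
      (cups m 0 (j + 1 + k) h).comp (sigma m (j + 2 + 2 * k)).val := by
  refine comp_eq_of_isotopic _ _ (Represents.sigma (by omega))
    (Represents.sigma (by omega)) ?_
  rw [cupSlices_zero, show j + 1 + k + 1 = j + 2 + k by omega]
  exact Isotopic.fold true j k

/-! ### Closing a braid by minima and their mirror image -/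

/-- The closure of the tangle `u` by a cup tangle and its mirror image. -/
def closed {m : ℕ} (y : Tangle 0 m) (u : (Tangle m m)ˣ) : Tangle 0 0 :=
  y.comp (u.val.comp y.flip)

/-- A braid above the minima reappears mirrored, that is inverted, below the maxima. -/
theorem closed_comp {m : ℕ} (y : Tangle 0 m) {u v : (Tangle m m)ˣ} (hv : FlipsToInv v) :
    closed (y.comp v.val) u = closed y (v * u * v⁻¹) := by
  unfold closed
  rw [flip_comp, hv, Units.val_mul, Units.val_mul]
  simp only [mul_def, comp_assoc]

theorem closed_comp_of_commute {m : ℕ} (y : Tangle 0 m) {u v : (Tangle m m)ˣ}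
    (hv : FlipsToInv v) (h : Commute v u) : closed (y.comp v.val) u = closed y u := by
  rw [closed_comp y hv, h.eq, mul_inv_cancel_right]

/-- The minima absorb `v⁻¹` too; mirroring this, the maxima absorb `v`. -/
theorem closed_mul_of_mem_absorbed {m : ℕ} {y : Tangle 0 m} {u v : (Tangle m m)ˣ}
    (hv : FlipsToInv v) (h : v ∈ absorbed y) : closed y (u * v) = closed y u := by
  have e : v⁻¹.val.flip = v.val := by
    have := FlipsToInv.inv hv
    unfold FlipsToInv at this
    rw [this, inv_inv]
  have h' : y.comp v⁻¹.val = y := inv_mem h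
  have : v.val.comp y.flip = y.flip := by
    rw [← e, ← flip_comp, h']
  unfold closed
  rw [Units.val_mul, mul_def, comp_assoc, this]

/-! ### Moving the columns -/

/-- The product of columns of crossings `a 1, …, a n`, the `i`-th one on the strands `2 p i` and
`2 p i + 1`. -/
noncomputable def columns (m n : ℕ) (p : ℕ → ℕ) (a : ℕ → ℤ) : (Tangle m m)ˣ :=
  ((List.range n).map fun i => sigma m (2 * p (i + 1)) ^ a (i + 1)).prod

theorem semiconjBy_columns {m n : ℕ} {p q : ℕ → ℕ} {a : ℕ → ℤ} {u : (Tangle m m)ˣ}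
    (h : ∀ i, 1 ≤ i → i ≤ n → SemiconjBy u (sigma m (2 * p i)) (sigma m (2 * q i))) :
    SemiconjBy u (columns m n p a) (columns m n q a) := by
  induction n with
  | zero => exact SemiconjBy.one_right _
  | succ n ih =>
    unfold columns at *
    rw [List.range_succ, List.map_append, List.map_append, List.prod_append, List.prod_append]
    refine (ih fun i h₁ h₂ => h i h₁ (by omega)).mul_right ?_
    simp only [List.map_cons, List.map_nil, List.prod_singleton]
    exact (h (n + 1) (by omega) le_rfl).zpow_right _

theorem sigma_comm_even (m c d : ℕ) : Commute (sigma m (2 * c)) (sigma m (2 * d)) := by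
  rcases lt_trichotomy c d with h | rfl | h
  · exact sigma_comm (by omega)
  · exact Commute.refl _
  · exact (sigma_comm (by omega)).symm

theorem sigma_comm_columns (m n c : ℕ) (p : ℕ → ℕ) (a : ℕ → ℤ) :
    Commute (sigma m (2 * c)) (columns m n p a) :=
  semiconjBy_columns fun _ _ _ => sigma_comm_even m c _

/-- The position of the `i`-th one of `n` columns when `j` columns have been sorted. -/
def columnPos (n j i : ℕ) : ℕ :=
  -- For even `n`, the unsorted columns fill the places `j, …, n - 1`: odd indices decreasing from
  -- `n - 1`, then even indices increasing to `n`.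
  if i ≤ j then i - 1 else if i % 2 = 1 then j + (n - 1 - i) / 2 else n - 1 - (n - i) / 2

/-- A pair of strands passing over columns to the right of it changes places with them. -/
theorem pairOver_semiconj_column {m j h c d : ℕ} (hm : 2 * j + 2 * h + 2 ≤ m)
    (H : (c = j + h ∧ d = j) ∨ (j ≤ c ∧ c < j + h ∧ d = c + 1) ∨
      ((c < j ∨ j + h < c) ∧ d = c)) :
    SemiconjBy (pairOver m (2 * j) (2 * h)) (sigma m (2 * c)) (sigma m (2 * d)) := by
  rcases H with ⟨rfl, rfl⟩ | ⟨h₁, h₂, rfl⟩ | ⟨h₁, rfl⟩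
  · rw [mul_add]; exact pairOver_semiconj_pair hm
  · exact pairOver_semiconj (q := 2 * (c + 1)) (by omega) (by omega) hm
  · exact pairOver_comm (by omega)

/-- For either parity of `j`, column `j + 1` stands just to the right of the `(n - 1 - j) / 2` other
odd columns still unsorted; it jumps to place `j` and they move up by one. -/
theorem pairOver_semiconj_columns {n j : ℕ} (hn : n % 2 = 0) (hj : j + 3 ≤ n) (a : ℕ → ℤ) :
    SemiconjBy (pairOver (2 * n) (2 * j) (2 * ((n - 1 - j) / 2)))
      (columns (2 * n) n (columnPos n j) a) (columns (2 * n) n (columnPos n (j + 1)) a) := by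
  refine semiconjBy_columns fun i h₁ h₂ => pairOver_semiconj_column (by omega) ?_
  unfold columnPos
  split_ifs <;> omega

/-- The diagram in which `j` columns have been sorted. -/
noncomputable def partlySorted (n j : ℕ) (a : ℕ → ℤ) (h : j + 1 ≤ n) : Tangle 0 0 :=
  closed ((cups (2 * n) j (n - 1 - j) (by omega)).comp
    (strandOver (2 * n) (2 * j) (n - 1 - j)).val) (columns (2 * n) n (columnPos n j) a)

/-- The last crossing has even position, so it commutes with all columns and cancels against its
mirror image. -/
theorem closed_strandOver_succ {m p k n : ℕ} (y : Tangle 0 m) (q : ℕ → ℕ) (a : ℕ → ℤ)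
    (h : (p + k) % 2 = 0) :
    closed (y.comp (strandOver m p (k + 1)).val) (columns m n q a) =
      closed (y.comp (strandOver m p k).val) (columns m n q a) := by
  obtain ⟨c, hc⟩ : ∃ c, p + k = 2 * c := ⟨(p + k) / 2, by omega⟩
  rw [strandOver_succ, comp_mul, closed_comp_of_commute _ (flipsToInv_sigma _ _)]
  rw [hc]
  exact sigma_comm_columns _ _ _ _ _

/-- Since `pairOver` is the product of the passages of its two strands, conjugating `u` by one
passage equals conjugating `v` by the inverse of the other. -/
theorem closed_move_pair {m p k : ℕ} (y : Tangle 0 m) {u v : (Tangle m m)ˣ}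
    (h : SemiconjBy (pairOver m p k) u v) :
    closed (y.comp (strandOver m p k).val) u =
      closed (y.comp ((strandOver m (p + 1) k)⁻¹).val) v := by
  rw [closed_comp _ (flipsToInv_strandOver _ _ _),
    closed_comp _ (FlipsToInv.inv (flipsToInv_strandOver _ _ _))]
  congr 1
  have h' : v = pairOver m p k * u * (pairOver m p k)⁻¹ := by rw [h.eq]; group
  rw [h', pairOver]
  group

theorem partlySorted_succ {n j : ℕ} (hn : n % 2 = 0) (hj : j + 3 ≤ n) (a : ℕ → ℤ) :
    partlySorted n j a (by omega) = partlySorted n (j + 1) a (by omega) := by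
  obtain ⟨r, rfl⟩ := Nat.exists_eq_add_of_le' hj
  have hs := pairOver_semiconj_columns hn hj a
  have key := cups_comp_strandOver (m := 2 * (r + (j + 3))) (j := j) (r := r + 1) (by omega)
  unfold partlySorted
  have e₁ : r + (j + 3) - 1 - j = r + 2 := by omega
  have e₂ : r + (j + 3) - 1 - (j + 1) = r + 1 := by omega
  simp only [e₁, e₂] at hs ⊢
  refine Eq.trans ?_ (congrArg (closed · _) key)
  rcases Nat.mod_two_eq_zero_or_one j with h | h
  -- The strand passes over an odd number of strands, while the pair passes over whole columns: its
  -- last crossing is dropped first.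
  · rw [show 2 * ((r + 2) / 2) = r + 1 by omega] at hs
    rw [closed_strandOver_succ _ _ _ (by omega), closed_move_pair _ hs]
  -- Here the inverse passage is one crossing too long for `key`; the excess is a curl on the
  -- innermost minimum.
  · rw [show 2 * ((r + 2) / 2) = r + 2 by omega] at hs
    rw [closed_move_pair _ hs, strandOver_succ, mul_inv_rev, comp_mul]
    congr 2
    exact inv_mem (sigma_mem_absorbed_cups (by omega))

theorem partlySorted_eq {n j : ℕ} (hn : n % 2 = 0) (hj : j + 2 ≤ n) (a : ℕ → ℤ) :
    partlySorted n 0 a (by omega) = partlySorted n j a (by omega) := by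
  induction j with
  | zero => rfl
  | succ j ih => exact (ih (by omega)).trans (partlySorted_succ hn (by omega) a)

end Tangle

namespace Tangle

/-! ### The two ends of the sorting: closed braid and pretzel diagram -/

theorem prod_even_mul_prod_odd {G : Type*} [Monoid G] (w : ℕ → G)
    (hw : ∀ s t, Commute (w s) (w t)) (h : ℕ) :
    ((List.range h).map fun t => w (2 * t)).prod * ((List.range h).map fun t => w (2 * t + 1)).prod =
      ((List.range (2 * h)).map w).prod := by
  induction h with
  | zero => simp
  | succ h ih =>
    have hc : Commute (w (2 * h)) ((List.range h).map fun t => w (2 * t + 1)).prod := by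
      refine Commute.list_prod_right _ _ fun x hx => ?_
      obtain ⟨t, -, rfl⟩ := List.mem_map.1 hx
      exact hw _ _
    rw [show 2 * (h + 1) = 2 * h + 1 + 1 by ring]
    simp only [List.range_succ, List.map_append, List.prod_append, List.map_cons, List.map_nil,
      List.prod_singleton]
    rw [← ih]
    simp only [mul_assoc]
    rw [← mul_assoc (w (2 * h)), hc.eq, mul_assoc]

/-- Commutation allows the quotient of two products to be checked factor by factor; used to replace
`B` by its folded copy. -/
theorem prod_inv_mul_prod_mem {G : Type*} [Group G] (H : Subgroup G) (u v : ℕ → G) (N : ℕ)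
    (h : ∀ t < N, (v t)⁻¹ * u t ∈ H) (hu : ∀ s t, Commute (v s) (u t))
    (hv : ∀ s t, Commute (v s) (v t)) :
    (((List.range N).map v).prod)⁻¹ * ((List.range N).map u).prod ∈ H := by
  induction N with
  | zero => simp
  | succ N ih =>
    have hcu : Commute (v N) ((List.range N).map u).prod := by
      refine Commute.list_prod_right _ _ fun x hx => ?_
      obtain ⟨t, -, rfl⟩ := List.mem_map.1 hx
      exact hu _ _
    have hcv : Commute (v N) ((List.range N).map v).prod := by
      refine Commute.list_prod_right _ _ fun x hx => ?_
      obtain ⟨t, -, rfl⟩ := List.mem_map.1 hx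
      exact hv _ _
    have hc := (hcv.inv_right.mul_right hcu).inv_left
    simp only [List.range_succ, List.map_append, List.prod_append, List.map_cons, List.map_nil,
      List.prod_singleton, mul_inv_rev]
    have := mul_mem (ih fun t ht => h t (by omega)) (h N (by omega))
    rw [← mul_assoc, ← hc.eq] at this
    simpa only [mul_assoc] using this

/-- The closure of the conjugated product of columns is a partly sorted diagram. -/
theorem closed_eq_partlySorted (h : ℕ) (a : ℕ → ℤ) :
    closed (cups (2 * (2 * h + 2)) 0 (2 * h + 1) (by omega))
      (strandOver _ 0 (2 * h) *
        ((List.range (h + 1)).map fun t => sigma _ (2 * (h - t)) ^ a (2 * t + 1)).prod *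
        (strandOver _ 0 (2 * h))⁻¹ *
        ((List.range (h + 1)).map fun t => sigma _ (2 * (h - t)) ^ a (2 * t + 2)).prod) =
      partlySorted (2 * h + 2) 0 a (by omega) := by
  set m := 2 * (2 * h + 2) with hm
  set y := cups m 0 (2 * h + 1) (by omega)
  set S := strandOver m 0 (2 * h)
  set A := ((List.range (h + 1)).map fun t => sigma m (2 * (h - t)) ^ a (2 * t + 1)).prod
  set B := ((List.range (h + 1)).map fun t => sigma m (2 * (h - t)) ^ a (2 * t + 2)).prod
  -- `B` folded along the nested arcs: place `h - t` goes to `h + 1 + t`.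
  set B' := ((List.range (h + 1)).map fun t => sigma m (2 * (h + 1 + t)) ^ a (2 * t + 2)).prod
  have hB : B'⁻¹ * B ∈ absorbed y ⊓ flipSubgroup m := by
    refine prod_inv_mul_prod_mem _ _ _ _ (fun t ht => ?_)
      (fun s t => (sigma_comm_even m _ _).zpow_zpow _ _)
      (fun s t => (sigma_comm_even m _ _).zpow_zpow _ _)
    rw [← inv_zpow, ← ((sigma_comm_even m _ _).inv_left).mul_zpow]
    refine zpow_mem (Subgroup.mem_inf.2 ⟨?_, ?_⟩) _
    · obtain ⟨j, rfl⟩ := Nat.exists_eq_add_of_le' (Nat.lt_succ_iff.1 ht)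
      have := cups_comp_sigma (m := m) (j := 2 * j) (k := 2 * t) (by omega)
      have e : y = cups m 0 (2 * j + 1 + 2 * t) (by omega) := by
        simp only [y, show 2 * (j + t) + 1 = 2 * j + 1 + 2 * t by ring]
      rw [← e, show 2 * j + 2 + 2 * (2 * t) = 2 * (j + t + 1 + t) by omega] at this
      rw [Nat.add_sub_cancel, ((sigma_comm_even m _ _).inv_left).eq]
      change y.comp _ = y
      rw [comp_mul, this, ← comp_mul, mul_inv_cancel]
      exact comp_one y
    · exact mul_mem (inv_mem (flipsToInv_sigma m _)) (flipsToInv_sigma m _)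
  -- `S` stays on the strands `0, …, 2h`, to the left of `B'`.
  have hSB : Commute S⁻¹ B' := by
    refine Commute.list_prod_right _ _ fun x hx => ?_
    obtain ⟨t, -, rfl⟩ := List.mem_map.1 hx
    exact (((sigma_comm_strandOver (by omega)).symm).zpow_right _).inv_left
  have hC : A * B' = columns m (2 * h + 2) (columnPos (2 * h + 2) 0) a := by
    rw [columns, show 2 * h + 2 = 2 * (h + 1) by ring, ← prod_even_mul_prod_odd _
      (fun s t => (sigma_comm_even m _ _).zpow_zpow _ _)]
    refine congrArg₂ _ (congrArg _ ?_) (congrArg _ ?_)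
    · refine List.map_congr_left fun t ht => ?_
      rw [List.mem_range] at ht
      rw [show columnPos (2 * (h + 1)) 0 (2 * t + 1) = h - t by
        unfold columnPos; split_ifs <;> omega]
    · refine List.map_congr_left fun t ht => ?_
      rw [List.mem_range] at ht
      rw [show columnPos (2 * (h + 1)) 0 (2 * t + 1 + 1) = h + 1 + t by
        unfold columnPos; split_ifs <;> omega]
  -- Replace `B` by `B'`, pull `B'` through `S⁻¹`, move `S` into the minima, and add the harmless
  -- crossing at `2h` required by `partlySorted`.
  rw [show S * A * S⁻¹ * B = (S * A * S⁻¹ * B') * (B'⁻¹ * B) by group,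
    closed_mul_of_mem_absorbed hB.2 hB.1, mul_assoc (S * A), hSB.eq, ← mul_assoc, mul_assoc S, hC,
    ← closed_comp y (flipsToInv_strandOver m 0 (2 * h)),
    ← closed_strandOver_succ y _ _ (by omega)]
  rfl

/-- All columns are in order, and the one crossing left of the passing strand has even position
`2r`, so it disappears. -/
theorem partlySorted_eq_closed (r : ℕ) (hr : r % 2 = 0) (a : ℕ → ℤ) :
    partlySorted (r + 2) r a (by omega) =
      closed (cups (2 * (r + 2)) r 1 (by omega)) (columns (2 * (r + 2)) (r + 2) (· - 1) a) := by
  have e : r + 2 - 1 - r = 1 := by omega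
  have hC : columns (2 * (r + 2)) (r + 2) (columnPos (r + 2) r) a =
      columns (2 * (r + 2)) (r + 2) (· - 1) a := by
    unfold columns
    congr 1
    refine List.map_congr_left fun t ht => ?_
    rw [List.mem_range] at ht
    rw [show columnPos (r + 2) r (t + 1) = t + 1 - 1 by unfold columnPos; split_ifs <;> omega]
  unfold partlySorted
  simp only [e]
  rw [closed_strandOver_succ _ _ _ (by omega), hC, strandOver_zero]
  exact congrArg (closed · _) (comp_one _)

theorem mk_eq_closed {m j r : ℕ} {h : 2 + 2 * j + 2 * r = m} {l : List Slice} {u : (Tangle m m)ˣ}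
    (hl : Represents l u)
    (H : IsTangle 0 (cupSlices j r ++ l ++ flipSlices (cupSlices j r)) 0) :
    mk _ H = closed (cups m j r h) u := by
  obtain ⟨hl, e⟩ := hl
  unfold closed
  rw [← e, ← comp_assoc]
  rfl

end Tangle

/-! ### Translation of the given diagrams and words; length of the word -/

theorem pretzelSlices_eq (r : ℕ) (a : ℕ → ℤ) :
    pretzelSlices (r + 2) a = cupSlices r 1 ++
      ((List.range (r + 2)).flatMap fun k => column (2 * k) (a (k + 1))) ++
      flipSlices (cupSlices r 1) := by
  have e : cupSlices r 1 = [⟨.cup, 0⟩] ++ ((List.range (r + 1)).map fun k => ⟨.cup, 2 * k + 1⟩) := by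
    simp [cupSlices, nestedCups, List.range_succ]
  rw [e, flipSlices_append]
  simp [pretzelSlices, flipSlices, List.map_reverse, Function.comp_def, Slice.flip, Piece.flip]

/-- The slices of a braid word. -/
def wordSlices (w : List ℤ) : List Slice :=
  w.map fun m => ⟨.cross (decide (0 < m)), m.natAbs - 1⟩

theorem closureSlices_eq (r : ℕ) (w : List ℤ) :
    closureSlices (r + 1) w = cupSlices 0 r ++ wordSlices w ++ flipSlices (cupSlices 0 r) := by
  rw [cupSlices_zero]
  simp [closureSlices, wordSlices, nestedCups, flipSlices, List.map_reverse, Function.comp_def,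
    Slice.flip, Piece.flip]

theorem wordSlices_generatorPow (i : ℕ) (a : ℤ) :
    wordSlices (generatorPow ((i : ℤ) + 1) a) = column i a := by
  simp only [wordSlices, generatorPow, column, List.map_replicate]
  rcases lt_trichotomy a 0 with h | rfl | h
  · rw [Int.sign_eq_neg_one_of_neg h, decide_eq_false (by omega), decide_eq_false (by omega)]
    congr 2; omega
  · rfl
  · rw [Int.sign_eq_one_of_pos h, decide_eq_true (by omega), decide_eq_true (by omega)]
    congr 2; omega

theorem ascending_eq (i j : ℤ) : ascending i j =
    if i ≤ j ∧ 0 < i * j then (List.range (j - i + 1).toNat).map fun k : ℕ => i + (k : ℤ)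
    else [] := by
  simp [ascending, List.pure_def, List.bind_eq_flatMap, ← List.map_eq_flatMap, Function.comp_def]

theorem wordSlices_ascending (k : ℕ) : wordSlices (ascending 1 k) = strandOverSlices 0 k := by
  rcases Nat.eq_zero_or_pos k with rfl | hk
  · rfl
  · rw [ascending_eq, if_pos (by omega), show ((k : ℤ) - 1 + 1).toNat = k by omega, wordSlices,
      strandOverSlices, List.map_map]
    refine List.map_congr_left fun t _ => ?_
    simp only [Function.comp]
    rw [decide_eq_true (by omega)]
    congr 1; omega

/-- The letters `-k, …, -1` are `1, …, k` read backwards with signs changed, which is what mirroring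
does. -/
theorem wordSlices_ascending_neg (k : ℕ) :
    wordSlices (ascending (-k) (-1)) = flipSlices (strandOverSlices 0 k) := by
  rcases Nat.eq_zero_or_pos k with rfl | hk
  · rfl
  · rw [ascending_eq, if_pos ⟨by omega, by simpa using hk⟩,
      show (-1 - -(k : ℤ) + 1).toNat = k by omega, wordSlices, strandOverSlices, flipSlices]
    refine List.ext_getElem (by simp) fun t h₁ h₂ => ?_
    simp only [List.length_map, List.length_range] at h₁
    simp only [List.getElem_map, List.getElem_range, List.getElem_reverse, List.length_map,
      List.length_range, Slice.flip, Piece.flip, Bool.not_true]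
    rw [decide_eq_false (by omega)]
    congr 1; omega

theorem wordSlices_append (w w' : List ℤ) :
    wordSlices (w ++ w') = wordSlices w ++ wordSlices w' := List.map_append

theorem mem_ascending {i j x : ℤ} (h : x ∈ ascending i j) : i ≤ x ∧ x ≤ j ∧ 0 < i * j := by
  rw [ascending_eq] at h
  split_ifs at h with hij
  · obtain ⟨t, ht, rfl⟩ := List.mem_map.1 h
    rw [List.mem_range] at ht
    exact ⟨by omega, by omega, hij.2⟩
  · simp at h

theorem isBraidWord_evenPretzelBraid (h : ℕ) (a : ℕ → ℤ) :
    IsBraidWord (2 * h + 2) (evenPretzelBraid (2 * h + 2) a) := by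
  have key (t : ℕ) (ht : t < (2 * h + 2) / 2) (b x : ℤ)
      (hx : x ∈ generatorPow (((2 * h + 2 : ℕ) : ℤ) - 1 - 2 * (t : ℤ)) b) :
      1 ≤ x.natAbs ∧ x.natAbs + 1 ≤ 2 * h + 2 := by
    unfold generatorPow at hx
    rw [List.eq_of_mem_replicate hx, Int.natAbs_mul, Int.natAbs_sign_of_ne_zero, one_mul]
    · omega
    · rintro rfl
      simp at hx
  intro x hx
  simp only [evenPretzelBraid, List.mem_append, List.mem_flatMap, List.mem_range] at hx
  rcases hx with ((hx | ⟨t, ht, hx⟩) | hx) | ⟨t, ht, hx⟩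
  · have := mem_ascending hx; omega
  · exact key t ht _ x hx
  · have := mem_ascending hx; omega
  · exact key t ht _ x hx

theorem length_ascending_one (k : ℕ) : (ascending 1 k).length = k := by
  have := congrArg List.length (wordSlices_ascending k)
  simpa [wordSlices, strandOverSlices] using this

theorem length_ascending_neg_one (k : ℕ) : (ascending (-k) (-1)).length = k := by
  have := congrArg List.length (wordSlices_ascending_neg k)
  simpa [wordSlices, strandOverSlices, flipSlices] using this

theorem length_columns_eq_sum (N : ℕ) (f : ℕ → ℤ) (a : ℕ → ℤ) (g : ℕ → ℕ) :
    (((List.range N).flatMap fun t => generatorPow (f t) (a (g t))).length : ℤ) =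
      ∑ t ∈ Finset.range N, |a (g t)| := by
  induction N with
  | zero => rfl
  | succ N ih =>
    rw [List.range_succ, List.flatMap_append, List.length_append, Finset.sum_range_succ, ← ih]
    simp [generatorPow]

theorem sum_abs_even_add_odd (h : ℕ) (a : ℕ → ℤ) :
    ∑ t ∈ Finset.range h, |a (2 * t + 1)| + ∑ t ∈ Finset.range h, |a (2 * t + 2)| =
      ∑ i ∈ Finset.Icc 1 (2 * h), |a i| := by
  induction h with
  | zero => simp
  | succ h ih =>
    rw [show 2 * (h + 1) = 2 * h + 1 + 1 by ring, Finset.sum_Icc_succ_top (by omega),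
      Finset.sum_Icc_succ_top (by omega), ← ih, Finset.sum_range_succ, Finset.sum_range_succ]
    ring

theorem length_evenPretzelBraid (h : ℕ) (a : ℕ → ℤ) :
    ((evenPretzelBraid (2 * h + 2) a).length : ℤ) =
      2 * ((2 * h + 2 : ℕ) : ℤ) + (∑ i ∈ Finset.Icc 1 (2 * h + 2), |a i|) - 4 := by
  have e : ((2 * h + 2 : ℕ) : ℤ) - 2 = ((2 * h : ℕ) : ℤ) := by push_cast; ring
  have := sum_abs_even_add_odd (h + 1) a
  rw [mul_add, mul_one] at this
  rw [evenPretzelBraid, e, ← this]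
  simp only [List.length_append, Nat.cast_add, length_columns_eq_sum, length_ascending_one,
    length_ascending_neg_one, show (2 * h + 2) / 2 = h + 1 by omega]
  push_cast
  ring

namespace Tangle

theorem represents_flatMap_generatorPow (h m : ℕ) (hm : 2 * h + 2 ≤ m) (b : ℕ → ℤ) :
    Represents (wordSlices ((List.range (h + 1)).flatMap fun j : ℕ =>
        generatorPow (((2 * h + 2 : ℕ) : ℤ) - 1 - 2 * (j : ℤ)) (b j)))
      ((List.range (h + 1)).map fun t => Tangle.sigma m (2 * (h - t)) ^ b t).prod := by
  rw [wordSlices, List.map_flatMap]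
  refine Represents.flatMap_range _ fun t ht => ?_
  have e : ((2 * h + 2 : ℕ) : ℤ) - 1 - 2 * (t : ℤ) = ((2 * (h - t) : ℕ) : ℤ) + 1 := by omega
  rw [e]
  have := Represents.column (m := m) (i := 2 * (h - t)) (by omega) (b t)
  rwa [← wordSlices_generatorPow] at this

theorem represents_evenPretzelBraid (h m : ℕ) (hm : 2 * h + 2 ≤ m) (a : ℕ → ℤ) :
    Represents (wordSlices (evenPretzelBraid (2 * h + 2) a))
      (strandOver m 0 (2 * h) *
        ((List.range (h + 1)).map fun t => Tangle.sigma m (2 * (h - t)) ^ a (2 * t + 1)).prod *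
        (strandOver m 0 (2 * h))⁻¹ *
        ((List.range (h + 1)).map fun t => Tangle.sigma m (2 * (h - t)) ^ a (2 * t + 2)).prod) := by
  have e : ((2 * h + 2 : ℕ) : ℤ) - 2 = ((2 * h : ℕ) : ℤ) := by push_cast; ring
  have hS : Represents (strandOverSlices 0 (2 * h)) (strandOver m 0 (2 * h)) :=
    Represents.strandOver (by omega)
  rw [evenPretzelBraid, e, show (2 * h + 2) / 2 = h + 1 by omega]
  simp only [wordSlices_append, wordSlices_ascending, wordSlices_ascending_neg]
  exact ((hS.append (represents_flatMap_generatorPow h m hm _)).append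
    (hS.flip (flipsToInv_strandOver _ _ _))).append (represents_flatMap_generatorPow h m hm _)

end Tangle

/-- For even `n > 2` and integers `a 1, …, a n` (the values of `a` at other arguments play no role),
`evenPretzelBraid n a` is a braid word on `n` strands, its closure represents the same link as the
pretzel diagram `P(a 1, …, a n)`, and it has `2 n + ∑ |a i| - 4` crossings. -/
theorem theorem2 (n : ℕ) (hn : 2 < n) (hn_even : Even n) (a : ℕ → ℤ) :
    ∃ hw : IsBraidWord n (evenPretzelBraid n a),
      (pretzelDiagram n a).SameLink (braidClosure n (evenPretzelBraid n a) hw) ∧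
      ((evenPretzelBraid n a).length : ℤ) = 2 * (n : ℤ) + (∑ i ∈ Finset.Icc 1 n, |a i|) - 4 := by
  obtain ⟨h, rfl⟩ : ∃ h, n = 2 * h + 2 := by
    obtain ⟨k, rfl⟩ := hn_even
    exact ⟨k - 1, by omega⟩
  refine ⟨isBraidWord_evenPretzelBraid h a, ?_, length_evenPretzelBraid h a⟩
  have hp : Tangle.Represents (m := 2 * (2 * h + 2))
      ((List.range (2 * h + 2)).flatMap fun k => column (2 * k) (a (k + 1)))
      (Tangle.columns _ (2 * h + 2) (· - 1) a) :=
    Tangle.Represents.flatMap_range _ fun k hk => Tangle.Represents.column (by omega) _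
  -- The braid is read on `2n` strands, the right half being the closing arcs.
  have hb := Tangle.represents_evenPretzelBraid h (2 * (2 * h + 2)) (by omega) a
  refine Tangle.sameLink _ _ ?_
  have H₁ := pretzelSlices_isTangle (2 * h + 2) a
  have H₂ := closureSlices_isTangle _ _ (isBraidWord_evenPretzelBraid h a)
  rw [Tangle.mk_congr (pretzelSlices_eq (2 * h) a) _ (pretzelSlices_eq (2 * h) a ▸ H₁),
    Tangle.mk_congr (closureSlices_eq (2 * h + 1) _) _ (closureSlices_eq (2 * h + 1) _ ▸ H₂),
    Tangle.mk_eq_closed (h := by omega) hp, Tangle.mk_eq_closed (h := by omega) hb,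
    Tangle.closed_eq_partlySorted, Tangle.partlySorted_eq (j := 2 * h) (by omega) (by omega),
    Tangle.partlySorted_eq_closed _ (by omega)]
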